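/- Let $\psi(q)=\sum_{k\ge 0}q^{k(k+1)/2}$ and define the integers $ps_3(n)$, $n\ge 0$, by the identity of formal power series $$\sum_{n\ge 0}ps_3(n)\,q^n=\frac{\psi(q^3)}{\psi(q)}.$$ Then for all integers $m\ge 1$ and $n\ge 0$, $$ps_3\!\left(3^{2m+1}n+\frac{3^{2m+2}-1}{4}\right)\equiv ps_3\!\left(3^{2m-1}n+\frac{3^{2m}-1}{4}\right)\pmod{3^{m+2}}.$$ -/

import Mathlib

open scoped Classical in
/-- Ramanujan's theta function `ψ(q) = ∑_{k ≥ 0} q^{k(k+1)/2}`, as a formal power series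
over `ℤ`. The numbers `k(k+1)/2`, `k ≥ 0`, are pairwise distinct, so every coefficient
is `0` or `1`. -/
noncomputable def ramanujanPsi : PowerSeries ℤ :=
  PowerSeries.mk fun n => if ∃ k : ℕ, k * (k + 1) / 2 = n then 1 else 0

/-- The quotient `ψ(q ^ 3) / ψ(q)` of formal power series; `ψ` has constant term `1`, hence it is
invertible over `ℤ` (see `psQuotient_mul_ramanujanPsi`). -/
noncomputable def psQuotient : PowerSeries ℤ :=
  PowerSeries.expand 3 three_ne_zero ramanujanPsi * PowerSeries.invOfUnit ramanujanPsi 1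

/-- `ps₃(n)`, the coefficient of `q ^ n` in `ψ(q ^ 3) / ψ(q)`. -/
noncomputable def ps3 (n : ℕ) : ℤ := PowerSeries.coeff n psQuotient

theorem constantCoeff_ramanujanPsi : PowerSeries.constantCoeff ramanujanPsi = 1 := by
  rw [← PowerSeries.coeff_zero_eq_constantCoeff_apply, ramanujanPsi, PowerSeries.coeff_mk,
    if_pos ⟨0, rfl⟩]

theorem psQuotient_mul_ramanujanPsi :
    psQuotient * ramanujanPsi = PowerSeries.expand 3 three_ne_zero ramanujanPsi := by
  rw [psQuotient, mul_assoc,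
    PowerSeries.invOfUnit_mul _ _ (by simpa using constantCoeff_ramanujanPsi), mul_one]

/-! Write U for `threeSection` and z for `psiQuotient`, that is q ψ(q^12)/ψ(q^4). Since `ps3 n` sits
at exponent 4n + 1 of z, the two sides of the congruence are the coefficients of U^(2m+1) z and
U^(2m-1) z at q^(4n+3). It suffices that 3^(m+2) divides the difference of these series.

Gauss' product for ψ computes the norm of ψ over q ↦ q^3. Combined with the 3-dissection of ψ it
gives a cubic for z over ℤ[z(q^3)] (`psiQuotient_pow_three`) and the values U z = z^3 and U(z^2).
The cubic becomes a recurrence, so every U(z^n) is an integer polynomial in z.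

Put τ = z^4 - 1. Explicitly, U^3 z - U z lies in 27 z^3 τ ℤ[3τ]. Moreover U maps z^3 τ ℤ[3τ] into z
τ ℤ[3τ], and z τ ℤ[3τ] into 3 z^3 τ ℤ[3τ]. Hence each further pair of applications of U gains a
factor 3. -/

open PowerSeries Finset

/-! ### Gauss' product for ψ, through Shanks' finite identity -/

section Shanks

variable {R : Type*} [CommRing R]

/-- `∏_{i < n} (1 - x ^ (2 i + 1))`. -/
def oddProd (x : R) (n : ℕ) : R := ∏ i ∈ range n, (1 - x ^ (2 * i + 1))

/-- `∏_{i < n} (1 - x ^ (2 i + 2))`. -/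
def evenProd (x : R) (n : ℕ) : R := ∏ i ∈ range n, (1 - x ^ (2 * i + 2))

theorem map_oddProd {S : Type*} [CommRing S] (f : R →+* S) (x : R) (n : ℕ) :
    f (oddProd x n) = oddProd (f x) n := by
  simp [oddProd]

theorem map_evenProd {S : Type*} [CommRing S] (f : R →+* S) (x : R) (n : ℕ) :
    f (evenProd x n) = evenProd (f x) n := by
  simp [evenProd]

theorem shanks_telescope (x : R) (n r : ℕ) (hr : r ≤ n + 1) :
    ∑ s ∈ range r, oddProd x s * (∏ i ∈ Ico (s + 1) (n + 1), (1 - x ^ (2 * i))) *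
        x ^ (s * (2 * n + 1)) * ((1 - x ^ (2 * n + 2)) * x ^ (2 * s) - (1 - x ^ (2 * n + 1))) =
      x ^ (r * (2 * n + 1)) * oddProd x r * ∏ i ∈ Ico r (n + 1), (1 - x ^ (2 * i)) := by
  induction r with
  | zero =>
    -- The factor at `i = 0` is `1 - x ^ 0 = 0`, so the right side starts at 0.
    rw [prod_eq_prod_Ico_succ_bot (Nat.succ_pos n)]
    simp
  | succ r ih =>
    rw [sum_range_succ, ih (by omega), prod_eq_prod_Ico_succ_bot (show r < n + 1 by omega),
      oddProd, oddProd, prod_range_succ]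
    ring

/-- Shanks' finite form of Gauss' product for `∑ x ^ (k (k + 1) / 2)`. -/
theorem shanks_identity (x : R) (n : ℕ) :
    oddProd x n * ∑ k ∈ range (2 * n + 1), x ^ (k * (k + 1) / 2) =
      ∑ s ∈ range (n + 1), oddProd x s * (∏ i ∈ Ico (s + 1) (n + 1), (1 - x ^ (2 * i))) *
        x ^ (s * (2 * n + 1)) := by
  induction n with
  | zero => simp [oddProd]
  | succ n ih =>
    have h := shanks_telescope x n (n + 1) le_rfl
    simp only [mul_sub, sum_sub_distrib] at h
    rw [← sum_mul, ← sum_mul, ← ih] at h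
    have e1 : (2 * n + 1) * (2 * n + 1 + 1) / 2 = (n + 1) * (2 * n + 1) := by
      rw [show (2 * n + 1) * (2 * n + 1 + 1) = (n + 1) * (2 * n + 1) * 2 by ring]; simp
    have e2 : (2 * n + 1 + 1) * (2 * n + 1 + 1 + 1) / 2 = (n + 1) * (2 * n + 3) := by
      rw [show (2 * n + 1 + 1) * (2 * n + 1 + 1 + 1) = (n + 1) * (2 * n + 3) * 2 by ring]; simp
    -- Passing from n to n + 1 multiplies the s-th term by `(1 - x ^ (2 * n + 2)) * x ^ (2 * s)`,
    -- the first half of the telescoping factor in `h`.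
    have e3 : ∑ s ∈ range (n + 1), oddProd x s *
          (∏ i ∈ Ico (s + 1) (n + 1 + 1), (1 - x ^ (2 * i))) * x ^ (s * (2 * (n + 1) + 1)) =
        ∑ s ∈ range (n + 1), oddProd x s * (∏ i ∈ Ico (s + 1) (n + 1), (1 - x ^ (2 * i))) *
          x ^ (s * (2 * n + 1)) * ((1 - x ^ (2 * n + 2)) * x ^ (2 * s)) := by
      refine sum_congr rfl fun s hs => ?_
      rw [prod_Ico_succ_top (by have := mem_range.1 hs; omega)]
      ring
    rw [sum_range_succ _ (n + 1), e3, show 2 * (n + 1) + 1 = 2 * n + 1 + 1 + 1 by ring,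
      sum_range_succ, sum_range_succ, e1, e2]
    simp only [Ico_self, prod_empty] at h ⊢
    rw [show oddProd x (n + 1) = oddProd x n * (1 - x ^ (2 * n + 1)) by
      simp [oddProd, prod_range_succ]] at h ⊢
    linear_combination -h

end Shanks

theorem triangle_strictMono : StrictMono fun k : ℕ => k * (k + 1) / 2 :=
  strictMono_nat_of_lt_succ fun k => by
    have : (k + 1) * (k + 1 + 1) = k * (k + 1) + (k + 1) * 2 := by ring
    simp only [this]
    omega

theorem X_pow_dvd_ramanujanPsi_sub (N : ℕ) :
    (X : ℤ⟦X⟧) ^ N ∣ ramanujanPsi - ∑ k ∈ range N, X ^ (k * (k + 1) / 2) := by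
  rw [X_pow_dvd_iff]
  intro m hm
  rw [map_sub, map_sum, ramanujanPsi, coeff_mk, sub_eq_zero]
  simp only [coeff_X_pow]
  split_ifs with h
  · obtain ⟨k, rfl⟩ := h
    have hk : k < N := lt_of_le_of_lt (triangle_strictMono.id_le k) hm
    rw [sum_eq_single_of_mem k (mem_range.2 hk), if_pos rfl]
    intro b _ hb
    exact if_neg fun e => hb (triangle_strictMono.injective e.symm)
  · exact (sum_eq_zero fun k _ => if_neg fun e => h ⟨k, e.symm⟩).symm

theorem X_pow_dvd_oddProd_mul_ramanujanPsi_sub (n : ℕ) :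
    (X : ℤ⟦X⟧) ^ (2 * n + 1) ∣ oddProd X n * ramanujanPsi - evenProd X n := by
  have h1 := (X_pow_dvd_ramanujanPsi_sub (2 * n + 1)).mul_left (oddProd X n)
  rw [mul_sub, shanks_identity, sum_range_succ'] at h1
  -- Modulo X^(2n+1) only the term s = 0 of Shanks' sum survives, and it is the even product.
  have h2 : (X : ℤ⟦X⟧) ^ (2 * n + 1) ∣ ∑ s ∈ range n, oddProd X (s + 1) *
      (∏ i ∈ Ico (s + 1 + 1) (n + 1), (1 - (X : ℤ⟦X⟧) ^ (2 * i))) *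
        X ^ ((s + 1) * (2 * n + 1)) :=
    dvd_sum fun s _ => (pow_dvd_pow _ (Nat.le_mul_of_pos_left _ s.succ_pos)).mul_left _
  have h3 : ∏ i ∈ Ico (0 + 1) (n + 1), (1 - (X : ℤ⟦X⟧) ^ (2 * i)) = evenProd X n := by
    rw [evenProd, prod_Ico_eq_prod_range]
    refine prod_congr rfl fun i _ => ?_
    ring
  have h := dvd_add h1 h2
  rw [← sub_sub, sub_right_comm, sub_add_cancel, h3] at h
  simpa [oddProd] using h

/-! ### The norm of ψ over q ↦ q^3 -/

/-- As 3 ∤ k, the powers 1, w^k, w^(2k) are again 1, w, w^2 in some order, and the product of 1 - v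
y over these v is 1 - y^3. -/
theorem norm_one_sub_pow {S : Type*} [CommRing S] {w : S} (hw : w ^ 2 + w + 1 = 0) (x : S)
    (k : ℕ) (hk : ¬ 3 ∣ k) :
    (1 - x ^ k) * (1 - (w * x) ^ k) * (1 - (w ^ 2 * x) ^ k) = 1 - (x ^ 3) ^ k := by
  have h3 : w ^ 3 = 1 := by linear_combination (w - 1) * hw
  have hk' : w ^ (2 * k) + w ^ k + 1 = 0 := by
    have hd : ∀ r, w ^ (3 * (k / 3) + r) = w ^ r := fun r => by
      rw [pow_add, pow_mul, h3, one_pow, one_mul]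
    rw [mul_comm, pow_mul]
    obtain h | h : k % 3 = 1 ∨ k % 3 = 2 := by omega
    · rw [← Nat.div_add_mod k 3, h, hd]
      linear_combination hw
    · rw [← Nat.div_add_mod k 3, h, hd]
      linear_combination w * h3 + hw
  have h3' : w ^ (3 * k) = 1 := by rw [pow_mul, h3, one_pow]
  simp only [mul_pow, ← pow_mul]
  rw [mul_comm 3 k, mul_comm k 3] at *
  have e : x ^ (3 * k) = (x ^ k) ^ 3 := by rw [mul_comm, pow_mul]
  have e2 : w ^ (2 * k) = (w ^ k) ^ 2 := by rw [mul_comm, pow_mul]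
  have e3 : w ^ (3 * k) = (w ^ k) ^ 3 := by rw [mul_comm, pow_mul]
  rw [e]
  rw [e2] at *
  rw [e3] at h3'
  linear_combination (-(x ^ k) + w ^ k * (x ^ k) ^ 2) * hk' - (x ^ k) ^ 3 * h3'

/-- Factors whose exponent is a multiple of 3 are fixed by x ↦ w x and enter cubed; the others
follow `norm_one_sub_pow`. The product in x^9 compensates for the multiples of 3 included in
`oddProd (x ^ 3) (3 * m)`. -/
theorem norm_oddProd {S : Type*} [CommRing S] {w : S} (hw : w ^ 2 + w + 1 = 0) (x : S) (m : ℕ) :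
    oddProd x (3 * m) * oddProd (w * x) (3 * m) * oddProd (w ^ 2 * x) (3 * m) *
        oddProd (x ^ 9) m =
      oddProd (x ^ 3) (3 * m) * oddProd (x ^ 3) m ^ 3 := by
  have h3 : w ^ 3 = 1 := by linear_combination (w - 1) * hw
  induction m with
  | zero => simp [oddProd]
  | succ m ih =>
    have s3 : ∀ y : S, oddProd y (3 * (m + 1)) = oddProd y (3 * m) * (1 - y ^ (2 * (3 * m) + 1)) *
        (1 - y ^ (2 * (3 * m + 1) + 1)) * (1 - y ^ (2 * (3 * m + 2) + 1)) := fun y => by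
      rw [oddProd, oddProd, mul_add, mul_one, prod_range_succ, prod_range_succ, prod_range_succ]
    have s1 : ∀ y : S, oddProd y (m + 1) = oddProd y m * (1 - y ^ (2 * m + 1)) := fun y => by
      rw [oddProd, oddProd, prod_range_succ]
    have a1 := norm_one_sub_pow hw x (2 * (3 * m) + 1) (by omega)
    have a2 := norm_one_sub_pow hw x (2 * (3 * m + 2) + 1) (by omega)
    have b : ∀ v : S, v ^ 3 = 1 → (v * x) ^ (2 * (3 * m + 1) + 1) = (x ^ 3) ^ (2 * m + 1) :=
      fun v hv => by
        rw [show 2 * (3 * m + 1) + 1 = 3 * (2 * m + 1) by ring, pow_mul, mul_pow, hv, one_mul]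
    have b0 := b 1 (one_pow 3)
    rw [one_mul] at b0
    have b1 := b w h3
    have b2 := b (w ^ 2) (by rw [← pow_mul, mul_comm, pow_mul, h3, one_pow])
    have b3 : (x ^ 9) ^ (2 * m + 1) = (x ^ 3) ^ (2 * (3 * m + 1) + 1) := by
      rw [← pow_mul, ← pow_mul]; congr 1; ring
    simp only [s3, s1, b0, b1, b2, b3]
    rw [← a1, ← a2]
    linear_combination (1 - x ^ (2 * (3 * m) + 1)) * (1 - (w * x) ^ (2 * (3 * m) + 1)) *
      (1 - (w ^ 2 * x) ^ (2 * (3 * m) + 1)) * (1 - x ^ (2 * (3 * m + 2) + 1)) *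
      (1 - (w * x) ^ (2 * (3 * m + 2) + 1)) * (1 - (w ^ 2 * x) ^ (2 * (3 * m + 2) + 1)) *
      (1 - (x ^ 3) ^ (2 * m + 1)) ^ 3 * (1 - (x ^ 3) ^ (2 * (3 * m + 1) + 1)) * ih

theorem norm_evenProd {S : Type*} [CommRing S] {w : S} (hw : w ^ 2 + w + 1 = 0) (x : S) (m : ℕ) :
    evenProd x (3 * m) * evenProd (w * x) (3 * m) * evenProd (w ^ 2 * x) (3 * m) *
        evenProd (x ^ 9) m =
      evenProd (x ^ 3) (3 * m) * evenProd (x ^ 3) m ^ 3 := by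
  have h3 : w ^ 3 = 1 := by linear_combination (w - 1) * hw
  induction m with
  | zero => simp [evenProd]
  | succ m ih =>
    have s3 : ∀ y : S, evenProd y (3 * (m + 1)) = evenProd y (3 * m) *
        (1 - y ^ (2 * (3 * m) + 2)) * (1 - y ^ (2 * (3 * m + 1) + 2)) *
        (1 - y ^ (2 * (3 * m + 2) + 2)) := fun y => by
      rw [evenProd, evenProd, mul_add, mul_one, prod_range_succ, prod_range_succ, prod_range_succ]
    have s1 : ∀ y : S, evenProd y (m + 1) = evenProd y m * (1 - y ^ (2 * m + 2)) := fun y => by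
      rw [evenProd, evenProd, prod_range_succ]
    have a1 := norm_one_sub_pow hw x (2 * (3 * m) + 2) (by omega)
    have a2 := norm_one_sub_pow hw x (2 * (3 * m + 1) + 2) (by omega)
    have b : ∀ v : S, v ^ 3 = 1 → (v * x) ^ (2 * (3 * m + 2) + 2) = (x ^ 3) ^ (2 * m + 2) :=
      fun v hv => by
        rw [show 2 * (3 * m + 2) + 2 = 3 * (2 * m + 2) by ring, pow_mul, mul_pow, hv, one_mul]
    have b0 := b 1 (one_pow 3)
    rw [one_mul] at b0
    have b1 := b w h3
    have b2 := b (w ^ 2) (by rw [← pow_mul, mul_comm, pow_mul, h3, one_pow])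
    have b3 : (x ^ 9) ^ (2 * m + 2) = (x ^ 3) ^ (2 * (3 * m + 2) + 2) := by
      rw [← pow_mul, ← pow_mul]; congr 1; ring
    simp only [s3, s1, b0, b1, b2, b3]
    rw [← a1, ← a2]
    linear_combination (1 - x ^ (2 * (3 * m) + 2)) * (1 - (w * x) ^ (2 * (3 * m) + 2)) *
      (1 - (w ^ 2 * x) ^ (2 * (3 * m) + 2)) * (1 - x ^ (2 * (3 * m + 1) + 2)) *
      (1 - (w * x) ^ (2 * (3 * m + 1) + 2)) * (1 - (w ^ 2 * x) ^ (2 * (3 * m + 1) + 2)) *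
      (1 - (x ^ 3) ^ (2 * m + 2)) ^ 3 * (1 - (x ^ 3) ^ (2 * (3 * m + 2) + 2)) * ih

theorem X_pow_dvd_map_sub_map {N : ℕ} {f g : ℂ⟦X⟧} (h : (X : ℂ⟦X⟧) ^ N ∣ f - g) (φ : ℂ⟦X⟧ →+* ℂ⟦X⟧)
    (hφ : (X : ℂ⟦X⟧) ∣ φ X) : (X : ℂ⟦X⟧) ^ N ∣ φ f - φ g := by
  rw [← map_sub]
  exact (pow_dvd_pow_of_dvd hφ N).trans (by simpa using map_dvd φ h)

theorem isUnit_oddProd {k : ℕ} (hk : k ≠ 0) (n : ℕ) : IsUnit (oddProd ((X : ℂ⟦X⟧) ^ k) n) := by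
  rw [isUnit_iff_constantCoeff, map_oddProd]
  simp [oddProd, hk]

theorem eq_of_forall_X_pow_dvd_sub {R : Type*} [CommRing R] {f g : R⟦X⟧}
    (h : ∀ n : ℕ, (X : R⟦X⟧) ^ n ∣ f - g) : f = g := by
  ext n
  have := X_pow_dvd_iff.1 (h (n + 1)) n n.lt_succ_self
  rwa [map_sub, sub_eq_zero] at this

/-- The norm of `ψ(q)` over `q ↦ q ^ 3` is `ψ(q ^ 3) ^ 4 / ψ(q ^ 9)`. -/
theorem norm_ramanujanPsi {w : ℂ} (hw : w ^ 2 + w + 1 = 0) {f : ℂ⟦X⟧}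
    (hf : ∀ n : ℕ, (X : ℂ⟦X⟧) ^ (2 * n + 1) ∣ oddProd X n * f - evenProd X n) :
    f * rescale w f * rescale (w ^ 2) f * expand 9 (by norm_num) f =
      expand 3 three_ne_zero f ^ 4 := by
  have hC : (C w : ℂ⟦X⟧) ^ 2 + C w + 1 = 0 := by
    rw [← map_pow, ← map_add, ← map_one C, ← map_add, hw, map_zero]
  refine eq_of_forall_X_pow_dvd_sub fun m => ?_
  -- Modulo X^m the finite products determine every transform of f, since odd products in positive
  -- powers of X are units.
  have key : ∀ (φ : ℂ⟦X⟧ →+* ℂ⟦X⟧) (n : ℕ), (X : ℂ⟦X⟧) ∣ φ X → m ≤ 2 * n + 1 →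
      Ideal.Quotient.mk (Ideal.span {(X : ℂ⟦X⟧) ^ m}) (oddProd (φ X) n) *
        Ideal.Quotient.mk _ (φ f) = Ideal.Quotient.mk _ (evenProd (φ X) n) := by
    intro φ n hφ hmn
    rw [← map_mul, Ideal.Quotient.mk_eq_mk_iff_sub_mem, Ideal.mem_span_singleton]
    have := X_pow_dvd_map_sub_map (hf n) φ hφ
    rw [map_mul, map_oddProd, map_evenProd] at this
    exact (pow_dvd_pow _ hmn).trans this
  have r0 := key (RingHom.id _) (3 * m) (by simp) (by omega)
  have r1 := key (rescale w) (3 * m) (by simp [rescale_X]) (by omega)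
  have r2 := key (rescale (w ^ 2)) (3 * m) (by simp [rescale_X]) (by omega)
  have r9 := key (expand 9 (by norm_num)).toRingHom m (by simp) (by omega)
  have r3 := key (expand 3 three_ne_zero).toRingHom m (by simp) (by omega)
  have r3' := key (expand 3 three_ne_zero).toRingHom (3 * m) (by simp) (by omega)
  simp only [RingHom.id_apply, rescale_X, AlgHom.toRingHom_eq_coe, RingHom.coe_coe, expand_X,
    map_pow] at r0 r1 r2 r9 r3 r3'
  have nO := congrArg (Ideal.Quotient.mk (Ideal.span {(X : ℂ⟦X⟧) ^ m}))
    (norm_oddProd hC (X : ℂ⟦X⟧) m)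
  have nE := congrArg (Ideal.Quotient.mk (Ideal.span {(X : ℂ⟦X⟧) ^ m}))
    (norm_evenProd hC (X : ℂ⟦X⟧) m)
  rw [← Ideal.mem_span_singleton, ← Ideal.Quotient.mk_eq_mk_iff_sub_mem]
  have u := ((isUnit_oddProd three_ne_zero (3 * m)).mul
    ((isUnit_oddProd three_ne_zero m).pow 3)).map
      (Ideal.Quotient.mk (Ideal.span {(X : ℂ⟦X⟧) ^ m}))
  refine u.mul_left_cancel ?_
  simp only [map_mul, map_pow] at nO nE ⊢
  generalize Ideal.Quotient.mk (Ideal.span {(X : ℂ⟦X⟧) ^ m}) = π at *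
  calc _ = (π (oddProd X (3 * m)) * π f) * (π (oddProd (C w * X) (3 * m)) * π (rescale w f)) *
        (π (oddProd (C w ^ 2 * X) (3 * m)) * π (rescale (w ^ 2) f)) *
        (π (oddProd (X ^ 9) m) * π (expand 9 (by norm_num) f)) := by rw [← nO]; ring
    _ = (π (oddProd (X ^ 3) (3 * m)) * π (expand 3 three_ne_zero f)) *
        (π (oddProd (X ^ 3) m) * π (expand 3 three_ne_zero f)) ^ 3 := by
      rw [r0, r1, r2, r9, r3, r3', nE]
    _ = _ := by ring

/-! ### The operator U and the 3-dissection of ψ -/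

/-- The `3`-section of a power series: `∑ a(n) q ^ n ↦ ∑ a(3 n) q ^ n`. -/
noncomputable def threeSection : ℤ⟦X⟧ →ₗ[ℤ] ℤ⟦X⟧ where
  toFun f := mk fun n => coeff (3 * n) f
  map_add' f g := by ext; simp
  map_smul' c f := by ext; simp only [map_zsmul, coeff_mk, RingHom.id_apply]

@[simp]
theorem coeff_threeSection (f : ℤ⟦X⟧) (n : ℕ) :
    coeff n (threeSection f) = coeff (3 * n) f := by
  simp [threeSection]

theorem threeSection_expand_mul (g f : ℤ⟦X⟧) :
    threeSection (expand 3 three_ne_zero g * f) = g * threeSection f := by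
  ext n
  rw [coeff_threeSection, coeff_mul, coeff_mul]
  symm
  refine sum_of_injOn (fun p => (3 * p.1, 3 * p.2)) ?_ ?_ ?_ ?_
  · rintro ⟨a, b⟩ _ ⟨c, d⟩ _ h
    simp only [Prod.mk.injEq] at h ⊢
    omega
  · rintro ⟨a, b⟩ h
    rw [mem_coe, HasAntidiagonal.mem_antidiagonal] at h ⊢
    simp only at h ⊢
    omega
  · rintro ⟨a, b⟩ h h'
    rw [coeff_expand_of_not_dvd, zero_mul]
    rintro ⟨c, rfl⟩
    rw [HasAntidiagonal.mem_antidiagonal] at h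
    refine h' ⟨(c, n - c), ?_, ?_⟩
    · rw [mem_coe, HasAntidiagonal.mem_antidiagonal]
      omega
    · simp only [Prod.mk.injEq, true_and]
      omega
  · rintro ⟨a, b⟩ h
    simp

theorem expand_nine {R : Type*} [CommRing R] (f : R⟦X⟧) :
    expand 9 (by norm_num) f = expand 3 three_ne_zero (expand 3 three_ne_zero f) := by
  rw [← expand_mul]

/-- With T(k) = k(k+1)/2, one has T(3j+1) = 9 T(j) + 1, while 3 divides T(k) for every k not
congruent to 1 mod 3. -/
theorem ramanujanPsi_eq_add :
    ramanujanPsi = expand 3 three_ne_zero (threeSection ramanujanPsi) +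
      X * expand 9 (by norm_num) ramanujanPsi := by
  have tri : ∀ k : ℕ, 2 * (k * (k + 1) / 2) = k * (k + 1) := fun k =>
    Nat.mul_div_cancel' (Nat.even_mul_succ_self k).two_dvd
  have tri1 : ∀ j : ℕ, (3 * j + 1) * (3 * j + 1 + 1) / 2 = 9 * (j * (j + 1) / 2) + 1 := fun j => by
    have := tri j
    have := tri (3 * j + 1)
    nlinarith
  have tri_mod : ∀ k : ℕ, k % 3 ≠ 1 → 3 ∣ k * (k + 1) / 2 := fun k hk => by
    have h : 3 ∣ 2 * (k * (k + 1) / 2) := by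
      rw [tri]
      obtain h | h : 3 ∣ k ∨ 3 ∣ k + 1 := by omega
      · exact h.mul_right _
      · exact h.mul_left _
    omega
  ext n
  rw [map_add, coeff_expand, coeff_threeSection]
  rcases n with _ | n
  · simp
  rw [coeff_succ_X_mul, coeff_expand]
  by_cases h3 : 3 ∣ n + 1
  · rw [if_pos h3, Nat.mul_div_cancel' h3, if_neg (by omega), add_zero]
  rw [if_neg h3, zero_add]
  simp only [ramanujanPsi, coeff_mk]
  by_cases h : ∃ k : ℕ, k * (k + 1) / 2 = n + 1
  · rw [if_pos h]
    obtain ⟨k, hk⟩ := h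
    have hk1 : k % 3 = 1 := by
      by_contra hk1
      exact h3 (hk ▸ tri_mod k hk1)
    obtain ⟨j, rfl⟩ : ∃ j, k = 3 * j + 1 := ⟨k / 3, by omega⟩
    rw [tri1] at hk
    rw [if_pos (by omega), if_pos ⟨j, by omega⟩]
  · rw [if_neg h]
    split_ifs with h9 h'
    · obtain ⟨j, hj⟩ := h'
      exact absurd ⟨3 * j + 1, by rw [tri1]; omega⟩ h
    · rfl
    · rfl

/-- If ψ = A + B is the 3-dissection, with B = q ψ(q^9), the norm of ψ is A^3 + B^3. Equating this
with `norm_ramanujanPsi` gives the claim with q^3 in place of q, and `expand 3` is injective. -/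
theorem threeSection_ramanujanPsi_pow_three :
    (threeSection ramanujanPsi ^ 3 + X * expand 3 three_ne_zero ramanujanPsi ^ 3) *
      expand 3 three_ne_zero ramanujanPsi = ramanujanPsi ^ 4 := by
  obtain ⟨w, hw⟩ : ∃ w : ℂ, w ^ 2 + w + 1 = 0 := by
    have h := IsAlgClosed.exists_root (Polynomial.X ^ 2 + Polynomial.X + 1 : Polynomial ℂ)
      (by rw [show (Polynomial.X ^ 2 + Polynomial.X + 1 : Polynomial ℂ).degree = 2 by
        compute_degree!]; norm_num)
    obtain ⟨w, hw⟩ := h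
    exact ⟨w, by simpa using hw⟩
  have h3 : w ^ 3 = 1 := by linear_combination (w - 1) * hw
  set ι := PowerSeries.map (Int.castRingHom ℂ)
  have hι : Function.Injective ι := map_injective _ Int.cast_injective
  have h := norm_ramanujanPsi hw (f := ι ramanujanPsi) fun n => by
    have := map_dvd ι (X_pow_dvd_oddProd_mul_ramanujanPsi_sub n)
    simpa [map_oddProd, map_evenProd, ι] using this
  set a := threeSection ramanujanPsi
  have hres : ∀ (v : ℂ), v ^ 3 = 1 → rescale v (ι ramanujanPsi) =
      ι (expand 3 three_ne_zero a) + C v * ι (X * expand 9 (by norm_num) ramanujanPsi) := by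
    intro v hv
    have e3 : ∀ g : ℤ⟦X⟧, rescale v (ι (expand 3 three_ne_zero g)) =
        ι (expand 3 three_ne_zero g) := fun g => by
      ext n
      rw [coeff_rescale, coeff_map, coeff_expand]
      split_ifs with hn
      · obtain ⟨k, rfl⟩ := hn
        rw [pow_mul, hv, one_pow, one_mul]
      · simp
    conv_lhs => rw [ramanujanPsi_eq_add]
    rw [map_add, map_add, map_mul, map_mul, e3]
    rw [expand_nine, e3]
    simp [ι, a, rescale_X, mul_assoc]
  have hCw : (C w : ℂ⟦X⟧) ^ 2 + C w + 1 = 0 := by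
    rw [← map_pow, ← map_add, ← map_one C, ← map_add, hw, map_zero]
  have h0 : ι ramanujanPsi =
      ι (expand 3 three_ne_zero a) + ι (X * expand 9 (by norm_num) ramanujanPsi) := by
    rw [← map_add, ← ramanujanPsi_eq_add]
  rw [hres w h3, hres (w ^ 2) (by rw [← pow_mul, mul_comm, pow_mul, h3, one_pow]), h0, map_pow] at h
  have inj : Function.Injective (expand (R := ℤ) 3 three_ne_zero) := fun f g hfg => by
    ext n
    rw [← coeff_expand_mul 3 three_ne_zero f, hfg, coeff_expand_mul]
  refine inj (hι ?_)
  rw [← h0, ← map_expand, ← map_expand] at h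
  simp only [map_mul, map_add, map_pow, expand_X, ← expand_nine]
  rw [← h, h0]
  have : (C w : ℂ⟦X⟧) ^ 3 = 1 := by rw [← map_pow, h3, map_one]
  simp only [map_mul]
  set A := ι (expand 3 three_ne_zero a)
  set B := ι (expand 9 (by norm_num) ramanujanPsi)
  set x := ι X
  linear_combination (-(A ^ 2 * x * B ^ 2) - A * x ^ 2 * B ^ 3 * C w) * hCw - x ^ 3 * B ^ 4 * this

/-! ### The modular equation for z and the action of U on its powers -/

/-- `q ψ(q ^ 12) / ψ(q ^ 4)`; its coefficient at `q ^ (4 n + 1)` is `ps3 n`. -/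
noncomputable def psiQuotient : ℤ⟦X⟧ := X * expand 4 four_ne_zero psQuotient

theorem coeff_psiQuotient (n : ℕ) : coeff (4 * n + 1) psiQuotient = ps3 n := by
  rw [psiQuotient, coeff_succ_X_mul, coeff_expand_mul, ps3]

theorem coeff_threeSection_iterate (k : ℕ) (f : ℤ⟦X⟧) (n : ℕ) :
    coeff n (threeSection^[k] f) = coeff (3 ^ k * n) f := by
  induction k generalizing n with
  | zero => simp
  | succ k ih =>
    rw [Function.iterate_succ_apply', coeff_threeSection, ih, pow_succ, mul_assoc]

theorem threeSection_X_pow {k : ℕ} (hk : ¬ 3 ∣ k) : threeSection (X ^ k) = 0 := by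
  ext n
  rw [coeff_threeSection, coeff_X_pow, if_neg (fun h => hk ⟨n, h.symm⟩), map_zero]

theorem threeSection_one : threeSection 1 = 1 := by
  ext n
  simp [coeff_one]

theorem threeSection_expand (f : ℤ⟦X⟧) : threeSection (expand 3 three_ne_zero f) = f := by
  simpa [threeSection_one] using threeSection_expand_mul f 1

/-- The theta functions in the variable of `psiQuotient`, with their relations. -/
theorem exists_theta_relations : ∃ r a : ℤ⟦X⟧, r ≠ 0 ∧
    psiQuotient * r = X * expand 3 three_ne_zero r ∧
    r = expand 3 three_ne_zero a +
      X ^ 4 * expand 3 three_ne_zero (expand 3 three_ne_zero r) ∧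
    (a ^ 3 + X ^ 4 * expand 3 three_ne_zero r ^ 3) * expand 3 three_ne_zero r = r ^ 4 := by
  have comm : ∀ f : ℤ⟦X⟧, expand 4 four_ne_zero (expand 3 three_ne_zero f) =
      expand 3 three_ne_zero (expand 4 four_ne_zero f) := fun f => by
    rw [← expand_mul, ← expand_mul]
  refine ⟨expand 4 four_ne_zero ramanujanPsi,
    expand 4 four_ne_zero (threeSection ramanujanPsi), ?_, ?_, ?_, ?_⟩
  · intro h
    have := congrArg constantCoeff h
    rw [constantCoeff_expand, constantCoeff_ramanujanPsi, map_zero] at this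
    exact one_ne_zero this
  · rw [psiQuotient, mul_assoc, ← map_mul, psQuotient_mul_ramanujanPsi, comm]
  · conv_lhs => rw [ramanujanPsi_eq_add]
    simp only [expand_nine, map_add, map_mul, expand_X, comm]
  · rw [← map_pow _ ramanujanPsi, ← threeSection_ramanujanPsi_pow_three]
    simp only [map_mul, map_add, map_pow, expand_X, comm]

theorem expand_three_ne_zero {f : ℤ⟦X⟧} (hf : f ≠ 0) : expand 3 three_ne_zero f ≠ 0 := fun h =>
  hf <| by rw [← threeSection_expand f, h, map_zero]

/-- The modular equation of degree three for `psiQuotient`. -/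
theorem psiQuotient_pow_three :
    psiQuotient ^ 3 = expand 3 three_ne_zero psiQuotient -
      3 * expand 3 three_ne_zero psiQuotient ^ 2 * psiQuotient +
      3 * expand 3 three_ne_zero psiQuotient ^ 3 * psiQuotient ^ 2 := by
  obtain ⟨r, a, hr, h1, h2, h3⟩ := exists_theta_relations
  have hs := expand_three_ne_zero hr
  have h1' := congrArg (expand 3 three_ne_zero) h1
  have h3' := congrArg (expand 3 three_ne_zero) h3
  simp only [map_mul, map_add, map_pow, expand_X, ← pow_mul] at h1' h3'
  set z := psiQuotient
  set ζ := expand 3 three_ne_zero z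
  set s := expand 3 three_ne_zero r
  set t := expand 3 three_ne_zero s
  set b := expand 3 three_ne_zero a
  refine mul_right_cancel₀ (mul_ne_zero (pow_ne_zero 3 hr) (pow_ne_zero 3 hs)) ?_
  -- Substituting this into `h3'` cancels the X^12 t^3 terms, which leaves the cubic relation.
  have hb : b = r - X ^ 4 * t := by rw [h2]; ring
  rw [hb] at h3'
  calc z ^ 3 * (r ^ 3 * s ^ 3) = (z * r) ^ 3 * s ^ 3 := by ring
    _ = X ^ 3 * s ^ 2 * s ^ 4 := by rw [h1]; ring
    _ = (X ^ 3 * t) * s ^ 2 * r ^ 3 - 3 * (X ^ 3 * t) ^ 2 * s * r ^ 2 * (X * s) +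
        3 * (X ^ 3 * t) ^ 3 * r * (X * s) ^ 2 := by rw [← h3']; ring
    _ = _ := by rw [← h1, ← h1']; ring

theorem threeSection_psiQuotient : threeSection psiQuotient = psiQuotient ^ 3 := by
  obtain ⟨r, a, hr, h1, h2, h3⟩ := exists_theta_relations
  have h3' := congrArg (expand 3 three_ne_zero) h3
  -- From b^3 + (X^4 t)^3 the factor r = b + X^4 t cancels. The three remaining terms have
  -- X-exponents 1, 5, 9, and U keeps only the last.
  have e : psiQuotient * expand 3 three_ne_zero r ^ 3 =
      expand 3 three_ne_zero (expand 3 three_ne_zero r * a ^ 2) * X ^ 1 -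
      expand 3 three_ne_zero (expand 3 three_ne_zero r ^ 2 * a) * X ^ 5 +
      expand 3 three_ne_zero (X ^ 3 * expand 3 three_ne_zero r ^ 3) := by
    refine mul_right_cancel₀ hr ?_
    simp only [map_mul, map_add, map_pow, expand_X, ← pow_mul] at h3' ⊢
    set s := expand 3 three_ne_zero r
    set t := expand 3 three_ne_zero s
    set b := expand 3 three_ne_zero a
    calc psiQuotient * s ^ 3 * r = psiQuotient * r * s ^ 3 := by ring
      _ = X * s ^ 4 := by rw [h1]; ring
      _ = _ := by rw [← h3', h2]; ring
  have e' := congrArg threeSection e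
  rw [mul_comm psiQuotient, ← map_pow, threeSection_expand_mul, map_add, map_sub,
    threeSection_expand_mul, threeSection_expand_mul, threeSection_expand,
    threeSection_X_pow (by norm_num), threeSection_X_pow (by norm_num)] at e'
  refine mul_left_cancel₀ (pow_ne_zero 3 hr) ?_
  rw [e', mul_comm (r ^ 3), ← mul_pow, h1, map_pow]
  ring

theorem threeSection_psiQuotient_sq :
    threeSection (psiQuotient ^ 2) = 3 * psiQuotient ^ 6 - 2 * psiQuotient ^ 2 := by
  obtain ⟨r, a, hr, h1, h2, h3⟩ := exists_theta_relations
  have h3' := congrArg (expand 3 three_ne_zero) h3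
  -- The square of the expression used for U z: the X-exponents are 2, 6, 10, 14, 18, and U keeps 6
  -- and 18.
  have e : psiQuotient ^ 2 * expand 3 three_ne_zero r ^ 6 =
      expand 3 three_ne_zero (expand 3 three_ne_zero r ^ 2 * a ^ 4) * X ^ 2 +
      expand 3 three_ne_zero (3 * expand 3 three_ne_zero r ^ 4 * a ^ 2) * X ^ 10 -
      expand 3 three_ne_zero (2 * expand 3 three_ne_zero r ^ 5 * a) * X ^ 14 +
      expand 3 three_ne_zero (X ^ 6 * expand 3 three_ne_zero r ^ 6 -
        2 * X ^ 2 * a ^ 3 * expand 3 three_ne_zero r ^ 3) := by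
    refine mul_right_cancel₀ (pow_ne_zero 2 hr) ?_
    simp only [map_mul, map_add, map_sub, map_pow, expand_X, ← pow_mul, map_ofNat] at h3' ⊢
    set s := expand 3 three_ne_zero r
    set t := expand 3 three_ne_zero s
    set b := expand 3 three_ne_zero a
    calc psiQuotient ^ 2 * s ^ 6 * r ^ 2 = (psiQuotient * r) ^ 2 * s ^ 6 := by ring
      _ = X ^ 2 * (s ^ 4) ^ 2 := by rw [h1]; ring
      _ = _ := by rw [← h3', h2]; ring
  have e' := congrArg threeSection e
  rw [mul_comm (psiQuotient ^ 2), ← map_pow, threeSection_expand_mul, map_add, map_sub, map_add,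
    threeSection_expand_mul, threeSection_expand_mul, threeSection_expand_mul,
    threeSection_expand, threeSection_X_pow (by norm_num), threeSection_X_pow (by norm_num),
    threeSection_X_pow (by norm_num)] at e'
  refine mul_left_cancel₀ (pow_ne_zero 6 hr) ?_
  rw [e', map_pow]
  set s := expand 3 three_ne_zero r
  set z := psiQuotient
  calc _ = 3 * (X * s) ^ 6 - 2 * (X * s) ^ 2 * ((a ^ 3 + X ^ 4 * s ^ 3) * s) := by ring
    _ = _ := by rw [h3, ← h1]; ring

theorem threeSection_psiQuotient_pow_add_three (n : ℕ) :
    threeSection (psiQuotient ^ (n + 3)) =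
      3 * psiQuotient ^ 3 * threeSection (psiQuotient ^ (n + 2)) -
      3 * psiQuotient ^ 2 * threeSection (psiQuotient ^ (n + 1)) +
      psiQuotient * threeSection (psiQuotient ^ n) := by
  rw [← threeSection_expand_mul, ← threeSection_expand_mul, ← threeSection_expand_mul,
    ← map_sub, ← map_add]
  congr 1
  simp only [map_mul, map_pow, map_ofNat]
  linear_combination psiQuotient ^ n * psiQuotient_pow_three

theorem threeSection_psiQuotient_pow_3 : threeSection (psiQuotient ^ 3) =
    psiQuotient - 9 * psiQuotient ^ 5 + 9 * psiQuotient ^ 9 := by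
  rw [threeSection_psiQuotient_pow_add_three 0]
  simp only [Nat.reduceAdd, threeSection_psiQuotient_sq, pow_one, threeSection_psiQuotient,
      pow_zero, threeSection_one]
  ring

theorem threeSection_psiQuotient_pow_4 : threeSection (psiQuotient ^ 4) =
    10 * psiQuotient ^ 4 - 36 * psiQuotient ^ 8 + 27 * psiQuotient ^ 12 := by
  rw [threeSection_psiQuotient_pow_add_three 1]
  simp only [Nat.reduceAdd, threeSection_psiQuotient_pow_3, threeSection_psiQuotient_sq, pow_one,
      threeSection_psiQuotient]
  ring

theorem threeSection_psiQuotient_pow_5 : threeSection (psiQuotient ^ 5) =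
    -5 * psiQuotient ^ 3 + 60 * psiQuotient ^ 7 - 135 * psiQuotient ^ 11 +
        81 * psiQuotient ^ 15 := by
  rw [threeSection_psiQuotient_pow_add_three 2]
  simp only [Nat.reduceAdd, threeSection_psiQuotient_pow_4, threeSection_psiQuotient_pow_3,
      threeSection_psiQuotient_sq]
  ring

theorem threeSection_psiQuotient_pow_6 : threeSection (psiQuotient ^ 6) =
    psiQuotient ^ 2 - 54 * psiQuotient ^ 6 + 297 * psiQuotient ^ 10 - 486 * psiQuotient ^ 14
      + 243 * psiQuotient ^ 18 := by
  rw [threeSection_psiQuotient_pow_add_three 3]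
  simp only [Nat.reduceAdd, threeSection_psiQuotient_pow_5, threeSection_psiQuotient_pow_4,
      threeSection_psiQuotient_pow_3]
  ring

theorem threeSection_psiQuotient_pow_7 : threeSection (psiQuotient ^ 7) =
    28 * psiQuotient ^ 5 - 378 * psiQuotient ^ 9 + 1323 * psiQuotient ^ 13
      - 1701 * psiQuotient ^ 17 + 729 * psiQuotient ^ 21 := by
  rw [threeSection_psiQuotient_pow_add_three 4]
  simp only [Nat.reduceAdd, threeSection_psiQuotient_pow_6, threeSection_psiQuotient_pow_5,
      threeSection_psiQuotient_pow_4]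
  ring

theorem threeSection_psiQuotient_pow_8 : threeSection (psiQuotient ^ 8) =
    -8 * psiQuotient ^ 4 + 306 * psiQuotient ^ 8 - 2160 * psiQuotient ^ 12
      + 5508 * psiQuotient ^ 16 - 5832 * psiQuotient ^ 20 + 2187 * psiQuotient ^ 24 := by
  rw [threeSection_psiQuotient_pow_add_three 5]
  simp only [Nat.reduceAdd, threeSection_psiQuotient_pow_7, threeSection_psiQuotient_pow_6,
      threeSection_psiQuotient_pow_5]
  ring

theorem threeSection_psiQuotient_pow_9 : threeSection (psiQuotient ^ 9) =
    psiQuotient ^ 3 - 162 * psiQuotient ^ 7 + 2349 * psiQuotient ^ 11 - 10935 * psiQuotient ^ 15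
      + 21870 * psiQuotient ^ 19 - 19683 * psiQuotient ^ 23 + 6561 * psiQuotient ^ 27 := by
  rw [threeSection_psiQuotient_pow_add_three 6]
  simp only [Nat.reduceAdd, threeSection_psiQuotient_pow_8, threeSection_psiQuotient_pow_7,
      threeSection_psiQuotient_pow_6]
  ring

theorem threeSection_psiQuotient_pow_10 : threeSection (psiQuotient ^ 10) =
    55 * psiQuotient ^ 6 - 1782 * psiQuotient ^ 10 + 14850 * psiQuotient ^ 14
      - 51030 * psiQuotient ^ 18 + 83835 * psiQuotient ^ 22 - 65610 * psiQuotient ^ 26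
      + 19683 * psiQuotient ^ 30 := by
  rw [threeSection_psiQuotient_pow_add_three 7]
  simp only [Nat.reduceAdd, threeSection_psiQuotient_pow_9, threeSection_psiQuotient_pow_8,
      threeSection_psiQuotient_pow_7]
  ring

theorem threeSection_psiQuotient_pow_11 : threeSection (psiQuotient ^ 11) =
    -11 * psiQuotient ^ 5 + 957 * psiQuotient ^ 9 - 14553 * psiQuotient ^ 13
      + 82863 * psiQuotient ^ 17 - 224532 * psiQuotient ^ 21 + 312741 * psiQuotient ^ 25
      - 216513 * psiQuotient ^ 29 + 59049 * psiQuotient ^ 33 := by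
  rw [threeSection_psiQuotient_pow_add_three 8]
  simp only [Nat.reduceAdd, threeSection_psiQuotient_pow_10, threeSection_psiQuotient_pow_9,
      threeSection_psiQuotient_pow_8]
  ring

/-! ### The variable τ and the modules stable under U^2 -/

/-- `psiQuotient ^ 4 - 1`, which vanishes at the fixed point of the modular equation. -/
noncomputable def psiTau : ℤ⟦X⟧ := psiQuotient ^ 4 - 1

theorem psiTau_pow_three : psiTau ^ 3 =
    expand 3 three_ne_zero (57 * psiTau + 135 * psiTau ^ 2 + 81 * psiTau ^ 3) * psiTau ^ 2 +
    expand 3 three_ne_zero (120 * psiTau + 279 * psiTau ^ 2 + 162 * psiTau ^ 3) * psiTau +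
    expand 3 three_ne_zero (64 * psiTau + 144 * psiTau ^ 2 + 81 * psiTau ^ 3) := by
  have h := psiQuotient_pow_three
  simp only [psiTau, map_mul, map_add, map_sub, map_pow, map_ofNat, map_one]
  set z := psiQuotient
  set k := expand 3 three_ne_zero z
  -- Reducing powers of z modulo the cubic to degree at most 2 yields, in `h12`, a cubic for z^4
  -- over ℤ[k^4].
  have h4 : z ^ 4 = 3 * k ^ 4 + (k - 9 * k ^ 5) * z + (-3 * k ^ 2 + 9 * k ^ 6) * z ^ 2 := by
    linear_combination (z + 3 * k ^ 3) * h
  have h8 : z ^ 8 = -6 * k ^ 4 + 108 * k ^ 8 - 324 * k ^ 12 + 243 * k ^ 16 +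
      (33 * k ^ 5 - 405 * k ^ 9 + 1053 * k ^ 13 - 729 * k ^ 17) * z +
      (k ^ 2 - 81 * k ^ 6 + 594 * k ^ 10 - 1215 * k ^ 14 + 729 * k ^ 18) * z ^ 2 := by
    linear_combination (z ^ 4 + 3 * k ^ 4 + (k - 9 * k ^ 5) * z +
      (-3 * k ^ 2 + 9 * k ^ 6) * z ^ 2) * h4 + ((-3 * k ^ 2 + 9 * k ^ 6) ^ 2 * z +
      2 * (k - 9 * k ^ 5) * (-3 * k ^ 2 + 9 * k ^ 6) +
      3 * k ^ 3 * (-3 * k ^ 2 + 9 * k ^ 6) ^ 2) * h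
  have h12 : z ^ 12 = (30 * k ^ 4 - 108 * k ^ 8 + 81 * k ^ 12) * z ^ 8 +
      (-12 * k ^ 4 + 9 * k ^ 8) * z ^ 4 + k ^ 4 := by
    rw [show z ^ 12 = z ^ 8 * z ^ 4 by ring, h8, h4]
    linear_combination
      ((k ^ 2 - 81 * k ^ 6 + 594 * k ^ 10 - 1215 * k ^ 14 + 729 * k ^ 18) *
        (-3 * k ^ 2 + 9 * k ^ 6) * (z + 3 * k ^ 3) +
      (k ^ 2 - 81 * k ^ 6 + 594 * k ^ 10 - 1215 * k ^ 14 + 729 * k ^ 18) * (k - 9 * k ^ 5) +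
      (33 * k ^ 5 - 405 * k ^ 9 + 1053 * k ^ 13 - 729 * k ^ 17) * (-3 * k ^ 2 + 9 * k ^ 6)) * h
  linear_combination h12

theorem threeSection_mul_psiTau_pow_three (f : ℤ⟦X⟧) : threeSection (f * psiTau ^ 3) =
    (57 * psiTau + 135 * psiTau ^ 2 + 81 * psiTau ^ 3) * threeSection (f * psiTau ^ 2) +
    (120 * psiTau + 279 * psiTau ^ 2 + 162 * psiTau ^ 3) * threeSection (f * psiTau) +
    (64 * psiTau + 144 * psiTau ^ 2 + 81 * psiTau ^ 3) * threeSection f := by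
  rw [← threeSection_expand_mul, ← threeSection_expand_mul, ← threeSection_expand_mul,
    ← map_add, ← map_add]
  congr 1
  linear_combination f * psiTau_pow_three

theorem threeSection_ofNat_mul (n : ℕ) [n.AtLeastTwo] (f : ℤ⟦X⟧) :
    threeSection (ofNat(n) * f) = ofNat(n) * threeSection f := by
  rw [← threeSection_expand_mul, map_ofNat]

/-- If `threeSection` sends `f * psiTau * (3 * psiTau) ^ n` into the `ℤ[3 * psiTau]`-multiples of
`g` for small `n`, then it does so for all `n`. -/
theorem exists_threeSection_mul_pow {f g : ℤ⟦X⟧} {p q r : Polynomial ℤ}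
    (hp : 3 * psiTau * threeSection f = g * Polynomial.aeval (3 * psiTau) p)
    (hq : threeSection (f * psiTau) = g * Polynomial.aeval (3 * psiTau) q)
    (hr : 3 * threeSection (f * psiTau ^ 2) = g * Polynomial.aeval (3 * psiTau) r) (n : ℕ) :
    ∃ Q : Polynomial ℤ, threeSection (f * psiTau * (3 * psiTau) ^ n) =
      g * Polynomial.aeval (3 * psiTau) Q := by
  induction n using Nat.strong_induction_on with
  | _ n ih =>
  match n with
  | 0 => exact ⟨q, by rw [pow_zero, mul_one, hq]⟩
  | 1 => exact ⟨r, by rw [← hr, ← threeSection_ofNat_mul]; congr 1; ring⟩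
  | 2 =>
    -- All coefficients in the cubic for τ are divisible by τ(q^3), so U f enters only through τ U
    -- f; this is why `hp` suffices.
    refine ⟨(57 * .X + 45 * .X ^ 2 + 9 * .X ^ 3) * r + (360 * .X + 279 * .X ^ 2 + 54 * .X ^ 3) * q +
      (192 + 144 * .X + 27 * .X ^ 2) * p, ?_⟩
    rw [show f * psiTau * (3 * psiTau) ^ 2 = 9 * (f * psiTau ^ 3) by ring, threeSection_ofNat_mul,
      threeSection_mul_psiTau_pow_three]
    simp only [map_add, map_mul, map_pow, map_ofNat, Polynomial.aeval_X]
    linear_combination (171 * psiTau + 405 * psiTau ^ 2 + 243 * psiTau ^ 3) * hr +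
      9 * (120 * psiTau + 279 * psiTau ^ 2 + 162 * psiTau ^ 3) * hq +
      3 * (64 + 144 * psiTau + 81 * psiTau ^ 2) * hp
  | n + 3 =>
    obtain ⟨Q₀, h₀⟩ := ih n (by omega)
    obtain ⟨Q₁, h₁⟩ := ih (n + 1) (by omega)
    obtain ⟨Q₂, h₂⟩ := ih (n + 2) (by omega)
    refine ⟨(57 * .X + 45 * .X ^ 2 + 9 * .X ^ 3) * Q₂ + (360 * .X + 279 * .X ^ 2 +
        54 * .X ^ 3) * Q₁ +
      (576 * .X + 432 * .X ^ 2 + 81 * .X ^ 3) * Q₀, ?_⟩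
    set F := f * psiTau * (3 * psiTau) ^ n
    rw [show f * psiTau * (3 * psiTau) ^ (n + 1) = 3 * (F * psiTau) by simp only [F]; ring,
      threeSection_ofNat_mul] at h₁
    rw [show f * psiTau * (3 * psiTau) ^ (n + 2) = 9 * (F * psiTau ^ 2) by simp only [F]; ring,
      threeSection_ofNat_mul] at h₂
    rw [show f * psiTau * (3 * psiTau) ^ (n + 3) = 27 * (F * psiTau ^ 3) by simp only [F]; ring,
      threeSection_ofNat_mul, threeSection_mul_psiTau_pow_three]
    simp only [map_add, map_mul, map_pow, map_ofNat, Polynomial.aeval_X]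
    linear_combination 3 * (57 * psiTau + 135 * psiTau ^ 2 + 81 * psiTau ^ 3) * h₂ +
      9 * (120 * psiTau + 279 * psiTau ^ 2 + 162 * psiTau ^ 3) * h₁ +
      27 * (64 * psiTau + 144 * psiTau ^ 2 + 81 * psiTau ^ 3) * h₀

theorem exists_threeSection_mul_aeval {f g : ℤ⟦X⟧} {p q r : Polynomial ℤ}
    (hp : 3 * psiTau * threeSection f = g * Polynomial.aeval (3 * psiTau) p)
    (hq : threeSection (f * psiTau) = g * Polynomial.aeval (3 * psiTau) q)
    (hr : 3 * threeSection (f * psiTau ^ 2) = g * Polynomial.aeval (3 * psiTau) r)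
    (P : Polynomial ℤ) :
    ∃ Q : Polynomial ℤ, threeSection (f * psiTau * Polynomial.aeval (3 * psiTau) P) =
      g * Polynomial.aeval (3 * psiTau) Q := by
  induction P using Polynomial.induction_on' with
  | add P P' h h' =>
    obtain ⟨Q, hQ⟩ := h
    obtain ⟨Q', hQ'⟩ := h'
    exact ⟨Q + Q', by rw [map_add, mul_add, map_add, hQ, hQ', map_add, mul_add]⟩
  | monomial n c =>
    obtain ⟨Q, hQ⟩ := exists_threeSection_mul_pow hp hq hr n
    refine ⟨c * Q, ?_⟩
    rw [Polynomial.aeval_monomial, eq_intCast, mul_left_comm,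
      ← map_intCast (expand (R := ℤ) 3 three_ne_zero), threeSection_expand_mul, hQ, map_mul,
      map_intCast, mul_left_comm]

theorem threeSection_psiQuotient_mul_psiTau :
    threeSection (psiQuotient * psiTau) = 3 * psiQuotient ^ 3 * psiTau *
      (11 + 12 * (3 * psiTau) + 3 * (3 * psiTau) ^ 2) := by
  rw [show psiQuotient * psiTau = psiQuotient ^ 5 - psiQuotient by rw [psiTau]; ring,
    map_sub, threeSection_psiQuotient_pow_5, threeSection_psiQuotient, psiTau]
  ring

theorem threeSection_psiQuotient_mul_psiTau_sq :
    3 * threeSection (psiQuotient * psiTau ^ 2) = 3 * psiQuotient ^ 3 * psiTau *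
      (96 + 711 * (3 * psiTau) + 1197 * (3 * psiTau) ^ 2 + 810 * (3 * psiTau) ^ 3
       + 243 * (3 * psiTau) ^ 4 + 27 * (3 * psiTau) ^ 5) := by
  rw [show psiQuotient * psiTau ^ 2 = psiQuotient ^ 9 - 2 * psiQuotient ^ 5 +
      psiQuotient by rw [psiTau]; ring, map_add, map_sub, threeSection_ofNat_mul,
    threeSection_psiQuotient_pow_9, threeSection_psiQuotient_pow_5, threeSection_psiQuotient,
        psiTau]
  ring

theorem threeSection_psiQuotient_cube_mul_psiTau :
    threeSection (psiQuotient ^ 3 * psiTau) = psiQuotient * psiTau *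
      (73 + 222 * (3 * psiTau) + 201 * (3 * psiTau) ^ 2 + 72 * (3 * psiTau) ^ 3
       + 9 * (3 * psiTau) ^ 4) := by
  rw [show psiQuotient ^ 3 * psiTau = psiQuotient ^ 7 - psiQuotient ^ 3 by rw [psiTau]; ring,
    map_sub, threeSection_psiQuotient_pow_7, threeSection_psiQuotient_pow_3, psiTau]
  ring

theorem threeSection_psiQuotient_cube_mul_psiTau_sq :
    3 * threeSection (psiQuotient ^ 3 * psiTau ^ 2) = psiQuotient * psiTau *
      (384 + 5529 * (3 * psiTau) + 17190 * (3 * psiTau) ^ 2 + 22545 * (3 * psiTau) ^ 3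
       + 15201 * (3 * psiTau) ^ 4 + 5562 * (3 * psiTau) ^ 5 + 1053 * (3 * psiTau) ^ 6
       + 81 * (3 * psiTau) ^ 7) := by
  rw [show psiQuotient ^ 3 * psiTau ^ 2 = psiQuotient ^ 11 - 2 * psiQuotient ^ 7 +
      psiQuotient ^ 3 by rw [psiTau]; ring, map_add, map_sub, threeSection_ofNat_mul,
    threeSection_psiQuotient_pow_11, threeSection_psiQuotient_pow_7,
        threeSection_psiQuotient_pow_3, psiTau]
  ring

/-- This is where the factor 3 is gained. Polynomials in τ alone would not do: U(z τ^3) contains 64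
τ z^3, which the weight 9 from (3τ)^2 repairs. -/
theorem exists_threeSection_psiQuotient_mul (P : Polynomial ℤ) : ∃ Q : Polynomial ℤ,
    threeSection (psiQuotient * psiTau * Polynomial.aeval (3 * psiTau) P) =
      3 * psiQuotient ^ 3 * psiTau * Polynomial.aeval (3 * psiTau) Q := by
  refine exists_threeSection_mul_aeval (p := 1)
    (q := 11 + 12 * .X + 3 * .X ^ 2)
    (r := 96 + 711 * .X + 1197 * .X ^ 2 + 810 * .X ^ 3 + 243 * .X ^ 4 + 27 * .X ^ 5)
    ?_ ?_ ?_ P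
  · simp only [threeSection_psiQuotient, map_one, psiTau]
    ring
  · simp only [threeSection_psiQuotient_mul_psiTau, map_add, map_mul, map_pow, map_ofNat,
      Polynomial.aeval_X]
  · simp only [threeSection_psiQuotient_mul_psiTau_sq, map_add, map_mul, map_pow, map_ofNat,
      Polynomial.aeval_X]

theorem exists_threeSection_psiQuotient_cube_mul (P : Polynomial ℤ) : ∃ Q : Polynomial ℤ,
    threeSection (psiQuotient ^ 3 * psiTau * Polynomial.aeval (3 * psiTau) P) =
      psiQuotient * psiTau * Polynomial.aeval (3 * psiTau) Q := by
  refine exists_threeSection_mul_aeval (p := 3 + 9 * .X + 3 * .X ^ 2)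
    (q := 73 + 222 * .X + 201 * .X ^ 2 + 72 * .X ^ 3 + 9 * .X ^ 4)
    (r := 384 + 5529 * .X + 17190 * .X ^ 2 + 22545 * .X ^ 3 + 15201 * .X ^ 4 + 5562 * .X ^ 5 +
        1053 * .X ^ 6 + 81 * .X ^ 7)
    ?_ ?_ ?_ P
  · simp only [threeSection_psiQuotient_pow_3, map_add, map_mul, map_pow, map_ofNat,
      Polynomial.aeval_X, psiTau]
    ring
  · simp only [threeSection_psiQuotient_cube_mul_psiTau, map_add, map_mul, map_pow, map_ofNat,
      Polynomial.aeval_X]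
  · simp only [threeSection_psiQuotient_cube_mul_psiTau_sq, map_add, map_mul, map_pow, map_ofNat,
      Polynomial.aeval_X]

/-! ### Iteration and extraction of coefficients -/

theorem exists_threeSection_iterate_sub (m : ℕ) : ∃ Q : Polynomial ℤ,
    threeSection^[2 * m + 3] psiQuotient - threeSection^[2 * m + 1] psiQuotient =
      3 ^ (m + 3) * (psiQuotient ^ 3 * psiTau * Polynomial.aeval (3 * psiTau) Q) := by
  induction m with
  | zero =>
    -- The witness is (U(z^9) - U(z^5)) / (3 z^3 τ) written in 3τ, because U^2 z = z + 9 (z^9 -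
    -- z^5).
    refine ⟨43 + 249 * .X + 402 * .X ^ 2 + 270 * .X ^ 3 + 81 * .X ^ 4 + 9 * .X ^ 5, ?_⟩
    simp only [Nat.reduceMul, Nat.reduceAdd, Function.iterate_succ_apply', Function.iterate_zero,
      id_eq, threeSection_psiQuotient, threeSection_psiQuotient_pow_3]
    rw [show psiQuotient - 9 * psiQuotient ^ 5 + 9 * psiQuotient ^ 9 =
      psiQuotient + 9 * (psiQuotient ^ 9 - psiQuotient ^ 5) by ring, map_add,
      threeSection_ofNat_mul, map_sub, threeSection_psiQuotient,
      threeSection_psiQuotient_pow_9, threeSection_psiQuotient_pow_5]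
    simp only [map_add, map_mul, map_pow, map_ofNat, Polynomial.aeval_X, psiTau]
    ring
  | succ m ih =>
    obtain ⟨Q, hQ⟩ := ih
    obtain ⟨Q', hQ'⟩ := exists_threeSection_psiQuotient_cube_mul Q
    obtain ⟨Q'', hQ''⟩ := exists_threeSection_psiQuotient_mul Q'
    refine ⟨Q'', ?_⟩
    have h3 : ∀ f, threeSection (3 ^ (m + 3) * f) = 3 ^ (m + 3) * threeSection f := fun f => by
      rw [← threeSection_expand_mul, map_pow, map_ofNat]
    rw [show 2 * (m + 1) + 3 = 2 + (2 * m + 3) by ring,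
      show 2 * (m + 1) + 1 = 2 + (2 * m + 1) by ring, Function.iterate_add_apply _ 2,
      Function.iterate_add_apply _ 2]
    change threeSection (threeSection _) - threeSection (threeSection _) = _
    rw [← map_sub, ← map_sub, hQ, h3, h3, hQ', hQ'']
    ring

theorem theorem1p2 (m n : ℕ) (hm : 1 ≤ m) :
    ps3 (3 ^ (2 * m + 1) * n + (3 ^ (2 * m + 2) - 1) / 4) ≡
      ps3 (3 ^ (2 * m - 1) * n + (3 ^ (2 * m) - 1) / 4) [ZMOD 3 ^ (m + 2)] := by
  obtain ⟨m, rfl⟩ : ∃ k, m = k + 1 := ⟨m - 1, by omega⟩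
  -- The exponents match: 3^(2k+1) (4n+3) = 4 (3^(2k+1) n + (3^(2k+2) - 1)/4) + 1, where the
  -- division is exact.
  have index : ∀ k, ps3 (3 ^ (2 * k + 1) * n + (3 ^ (2 * k + 2) - 1) / 4) =
      coeff (4 * n + 3) (threeSection^[2 * k + 1] psiQuotient) := fun k => by
    rw [coeff_threeSection_iterate, ← coeff_psiQuotient]
    congr 2
    obtain ⟨d, hd⟩ : ∃ d, 3 ^ (2 * k + 2) = 4 * d + 1 := by
      have h : 3 ^ (2 * k + 2) % 4 = 1 := by
        rw [show 2 * k + 2 = 2 * (k + 1) by ring, pow_mul, Nat.pow_mod]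
        norm_num
      exact ⟨3 ^ (2 * k + 2) / 4, by omega⟩
    have h3 : 3 ^ (2 * k + 1) * 3 = 4 * d + 1 := by rw [← hd, pow_succ 3 (2 * k + 1)]
    rw [hd, Nat.add_sub_cancel, Nat.mul_div_cancel_left _ (by norm_num)]
    generalize 3 ^ (2 * k + 1) = t at h3 ⊢
    linarith
  rw [show 2 * (m + 1) - 1 = 2 * m + 1 by omega, show 2 * (m + 1) = 2 * m + 2 by ring, index m,
    show 2 * m + 2 = 2 * (m + 1) by ring, index (m + 1)]
  obtain ⟨Q, hQ⟩ := exists_threeSection_iterate_sub m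
  refine (Int.modEq_iff_dvd.2 ?_).symm
  rw [show 2 * (m + 1) + 1 = 2 * m + 3 by ring, ← map_sub, hQ]
  rw [show (3 : ℤ⟦X⟧) ^ (m + 3) = C (3 ^ (m + 3)) by simp, coeff_C_mul]
  exact dvd_mul_right _ _
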